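/- **Setting.** Let $\mathbb K=\mathbb R$ or $\mathbb C$, $N\ge 1$, $l\ge 1$, $m=2l$, $0<\rho\le 1$, and let $\Omega\subset\mathbb R^N$ be a bounded domain (nonempty, open, connected) whose boundary is of class $C^1$ (at least). $C^k(\overline\Omega)$ denotes the functions that are continuous on $\overline\Omega$, of class $C^k$ in $\Omega$, and all of whose partial derivatives of order $\le k$ extend continuously from $\Omega$ to $\overline\Omega$; derivatives at boundary points are understood as the values of these extensions. Write $D_j=\partial/\partial x_j$. Let $A(x,D)=\sum_{|\alpha|\le m}a_\alpha(x)D^\alpha$ with $a_\alpha\in C^{|\alpha|}(\overline\Omega)$ be * elliptic in $\Omega$: $(-1)^l\sum_{|\alpha|=m}a_\alpha(x)\xi^\alpha>0$ for all $x\in\Omega$, $0\ne\xi\in\mathbb R^N$; * formally selfadjoint and positive: $(A\eta,\theta)=(\eta,A\theta)$ and $(A\eta,\eta)>0$ for $\eta\neq0$, for all $\eta,\theta\in C_c^\infty(\Omega)$, where $(\cdot,\cdot)$ is the scalar product of $L_2(\Omega)$. For $j=1,\dots,l$ let $0\le m_j\le m-1$ and let $B_j=\sum_{|\alpha|\le m_j}b_{\alpha,j}(x)D^\alpha$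 with given functions $b_{\alpha,j}$ on $\partial\Omega$. Put $D(A)=\{g\in C^m(\overline\Omega): B_jg=0 \text{ on }\partial\Omega,\ j=1,\dots,l\}$. **Condition (A).** The operator $A(x,D)$ with domain $D(A)$ has a compact inverse in $L_2(\Omega)$, i.e. there is a compact linear operator $T$ on $L_2(\Omega)$ with $T(A(x,D)g)=g$ for all $g\in D(A)$; and there are functions $v_k\in D(A)$ and numbers $\lambda_k>0$, $k\in\mathbb N$, with $A(x,D)v_k=\lambda_kv_k$ in $\Omega$, such that $\{v_k\}$ is a complete orthonormal system in $L_2(\Omega)$. (Agmon's conditions on $\partial\Omega$ and on the coefficients of $A$ and $B_j$ are conditions that guarantee this.) **Fractional derivatives.** For $s<0$, $\partial_t^{s}h(t)=\frac1{\Gamma(-s)}\int_0^t (t-\xi)^{-s-1}h(\xi)\,d\xi$, $t>0$ (provided the integral exists); $\partial_t^0h=h$; and $\partial_t^\rho h=\frac{d}{dt}\partial_t^{\rho-1}h$ for $0<\rho\le1$ (Riemann–Liouville). **Problem.** Given $f$ and $\varphi$, consider $$\partial_t^\rho u(x,t)+A(x,D)u(x,t)=f(x,t),\quad x\in\Omega,\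 t>0;\qquad \lim_{t\to0+}\partial_t^{\rho-1}u(x,t)=\varphi(x),\quad x\in\Omega;$$ $$B_ju(x,t)=0,\quad j=1,\dots,l,\ x\in\partial\Omega,\ t>0.$$ A *regular solution* is a function $u:\overline\Omega\times(0,\infty)\to\mathbb K$ with $u(\cdot,t)\in C^m(\overline\Omega)$ for every $t>0$, for which $\partial_t^{\rho-1}u$ and $\partial_t^\rho u$ exist in $\Omega\times(0,\infty)$, such that $\partial_t^\rho u,\ A(x,D)u\in C(\overline\Omega\times(0,\infty))$ and $\partial_t^{\rho-1}u\in C(\overline\Omega\times[0,\infty))$ (in the sense of continuous extension from $\Omega\times(0,\infty)$), and which satisfies the three conditions of the problem pointwise. **Theorem.** Let condition (A) be satisfied, $f\in C(\overline\Omega\times(0,\infty))$ and $\varphi\in C(\overline\Omega)$. Then the problem has at most one regular solution: any two regular solutions coincide on $\overline\Omega\times(0,\infty)$. -/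

import Mathlib

open MeasureTheory Filter Topology Set

noncomputable section

namespace Subdiffusion

/-- The space `ℝ^N` with its Euclidean structure. -/
abbrev Sp (N : ℕ) : Type := EuclideanSpace ℝ (Fin N)

/-- The Hilbert space `L₂(Ω)`. -/
abbrev L2 (𝕜 : Type) [RCLike 𝕜] {N : ℕ} (Ω : Set (Sp N)) : Type :=
  Lp 𝕜 2 (volume.restrict Ω)

/-! ### Multi-indices and partial derivatives -/

/-- The multi-indices `α` with `|α| ≤ k`. -/
def multiIdx (N k : ℕ) : Finset (Fin N → ℕ) :=
  (Fintype.piFinset fun _ : Fin N => Finset.range (k + 1)).filter fun α => ∑ i, α i ≤ k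

/-- The partial derivative `D_i g = ∂g/∂x_i`. -/
def partialD {𝕜 : Type} [RCLike 𝕜] {N : ℕ} (i : Fin N) (g : Sp N → 𝕜) : Sp N → 𝕜 :=
  fun x => fderiv ℝ g x (EuclideanSpace.single i 1)

/-- `D^α g = D_1^{α_1} ⋯ D_N^{α_N} g`. -/
def multiD {𝕜 : Type} [RCLike 𝕜] {N : ℕ} (α : Fin N → ℕ) (g : Sp N → 𝕜) : Sp N → 𝕜 :=
  (List.finRange N).foldr (fun i h => (partialD i)^[α i] h) g

/-- `g ∈ C^k(Ω̄)`: `g` is `C^k` in the open set `Ω`, continuous on `Ω̄`, and every derivative of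
order at most `k` has a continuous extension from `Ω` to `Ω̄`. -/
def CkClosure {𝕜 : Type} [RCLike 𝕜] {N : ℕ} (Ω : Set (Sp N)) (k : ℕ) (g : Sp N → 𝕜) : Prop :=
  ContDiffOn ℝ k g Ω ∧ ContinuousOn g (closure Ω) ∧
    ∀ α ∈ multiIdx N k, ∃ G : Sp N → 𝕜, ContinuousOn G (closure Ω) ∧ EqOn G (multiD α g) Ω

/-! ### The domain -/

/-- `Ω` is a bounded domain with boundary of class `C¹`: near each boundary point, `Ω` is the set
where a `C¹` function with nonvanishing differential at that point is negative. -/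
structure IsSmoothBoundedDomain {N : ℕ} (Ω : Set (Sp N)) : Prop where
  isOpen : IsOpen Ω
  isConnected : IsConnected Ω
  isBounded : Bornology.IsBounded Ω
  boundary : ∀ x₀ ∈ frontier Ω, ∃ (W : Set (Sp N)) (ψ : Sp N → ℝ), IsOpen W ∧ x₀ ∈ W ∧
    ContDiffOn ℝ 1 ψ W ∧ ψ x₀ = 0 ∧ fderiv ℝ ψ x₀ ≠ 0 ∧ Ω ∩ W = {x ∈ W | ψ x < 0}

/-! ### The differential operators -/

/-- `(A(x,D) g)(x) = ∑_{|α| ≤ m} a_α(x) D^α g(x)`. -/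
def diffOp {𝕜 : Type} [RCLike 𝕜] {N : ℕ} (m : ℕ) (a : (Fin N → ℕ) → Sp N → 𝕜)
    (g : Sp N → 𝕜) : Sp N → 𝕜 :=
  fun x => ∑ α ∈ multiIdx N m, a α x * multiD α g x

/-- `∑_{|α| ≤ k} b_α(x) D^α g(x)` at boundary points `x`, where the values `D^α g(x)` are the limits
of `D^α g` from inside `Ω`. -/
def bdryOp {𝕜 : Type} [RCLike 𝕜] {N : ℕ} (Ω : Set (Sp N)) (k : ℕ) (b : (Fin N → ℕ) → Sp N → 𝕜)
    (g : Sp N → 𝕜) : Sp N → 𝕜 :=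
  fun x => ∑ α ∈ multiIdx N k, b α x * extendFrom Ω (multiD α g) x

/-- Test functions `C_c^∞(Ω)`. -/
def IsTest {𝕜 : Type} [RCLike 𝕜] {N : ℕ} (Ω : Set (Sp N)) (η : Sp N → 𝕜) : Prop :=
  ContDiff ℝ (⊤ : ℕ∞) η ∧ HasCompactSupport η ∧ tsupport η ⊆ Ω

/-- `A(x,D)` is a positive formally selfadjoint elliptic operator of order `2l` in `Ω` with smooth
coefficients. As `D_j` is `∂/∂x_j`, the principal symbol is
`∑_{|α| = 2l} a_α (iξ)^α = (-1)^l ∑_{|α| = 2l} a_α ξ^α`. -/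
structure IsPosSymmElliptic {𝕜 : Type} [RCLike 𝕜] {N : ℕ} (Ω : Set (Sp N)) (l : ℕ)
    (a : (Fin N → ℕ) → Sp N → 𝕜) : Prop where
  smooth : ∀ α ∈ multiIdx N (2 * l), CkClosure Ω (∑ i, α i) (a α)
  elliptic : ∀ x ∈ Ω, ∀ ξ : Fin N → ℝ, ξ ≠ 0 → ∃ r : ℝ, 0 < r ∧
    (-1 : 𝕜) ^ l * ∑ α ∈ (multiIdx N (2 * l)).filter (fun α => ∑ i, α i = 2 * l),
      a α x * ((∏ i, ξ i ^ α i : ℝ) : 𝕜) = (r : 𝕜)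
  symm : ∀ η θ : Sp N → 𝕜, IsTest Ω η → IsTest Ω θ →
    ∫ x in Ω, diffOp (2 * l) a η x * star (θ x) = ∫ x in Ω, η x * star (diffOp (2 * l) a θ x)
  pos : ∀ η : Sp N → 𝕜, IsTest Ω η → η ≠ 0 →
    0 < RCLike.re (∫ x in Ω, diffOp (2 * l) a η x * star (η x))

/-- The domain `D(A) = {g ∈ C^m(Ω̄) : B_j g = 0 on ∂Ω, j = 1, …, l}`, `m = 2l`. -/
def InDomain {𝕜 : Type} [RCLike 𝕜] {N : ℕ} (Ω : Set (Sp N)) (l : ℕ) (mB : Fin l → ℕ)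
    (b : Fin l → (Fin N → ℕ) → Sp N → 𝕜) (g : Sp N → 𝕜) : Prop :=
  CkClosure Ω (2 * l) g ∧ ∀ j, ∀ x ∈ frontier Ω, bdryOp Ω (mB j) (b j) g x = 0

/-- Condition (A) on the boundary problem `(A, {B_j}, Ω)`: the operator `A(x,D)` with domain `D(A)`
has a compact inverse in `L₂(Ω)`, and the spectral problem `A v = λ v`, `B_j v = 0`, has a system
of eigenfunctions `v_k` with positive eigenvalues `λ_k` that is orthonormal and complete
in `L₂(Ω)`. -/
structure ConditionA {𝕜 : Type} [RCLike 𝕜] {N : ℕ} (Ω : Set (Sp N)) (l : ℕ)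
    (a : (Fin N → ℕ) → Sp N → 𝕜) (mB : Fin l → ℕ)
    (b : Fin l → (Fin N → ℕ) → Sp N → 𝕜) : Prop where
  compact_inverse : ∃ T : L2 𝕜 Ω →L[𝕜] L2 𝕜 Ω, IsCompactOperator T ∧
    ∀ g : Sp N → 𝕜, InDomain Ω l mB b g → ∀ F G : L2 𝕜 Ω,
      F =ᵐ[volume.restrict Ω] diffOp (2 * l) a g → G =ᵐ[volume.restrict Ω] g → T F = G
  eigenfunctions : ∃ (v : ℕ → Sp N → 𝕜) (lam : ℕ → ℝ) (V : ℕ → L2 𝕜 Ω),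
    (∀ k, InDomain Ω l mB b (v k)) ∧
    (∀ k, 0 < lam k) ∧
    (∀ k, ∀ x ∈ Ω, diffOp (2 * l) a (v k) x = (lam k : 𝕜) * v k x) ∧
    (∀ k, V k =ᵐ[volume.restrict Ω] v k) ∧
    Orthonormal 𝕜 V ∧
    (Submodule.span 𝕜 (range V)).topologicalClosure = ⊤

/-! ### Riemann–Liouville integrals and derivatives -/

/-- `∂_t^s h(t)` for `s ≤ 0`: the Riemann–Liouville integral
`Γ(-s)⁻¹ ∫_0^t (t - ξ)^{-s-1} h(ξ) dξ` if `s < 0`, and `h(t)` if `s = 0`. -/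
def rlInt {𝕜 : Type} [RCLike 𝕜] (s : ℝ) (h : ℝ → 𝕜) (t : ℝ) : 𝕜 :=
  if s = 0 then h t
  else (Real.Gamma (-s))⁻¹ • ∫ ξ in (0 : ℝ)..t, ((t - ξ) ^ (-s - 1) : ℝ) • h ξ

/-- The right-hand side in the definition of `∂_t^s h(t)`, `s ≤ 0`, exists. -/
def RlIntExists {𝕜 : Type} [RCLike 𝕜] (s : ℝ) (h : ℝ → 𝕜) (t : ℝ) : Prop :=
  s ≠ 0 → IntervalIntegrable (fun ξ => ((t - ξ) ^ (-s - 1) : ℝ) • h ξ) volume 0 t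

/-- The Riemann–Liouville derivative `∂_t^ρ h = (d/dt) ∂_t^{ρ-1} h`, `0 < ρ ≤ 1`. -/
def rlDeriv {𝕜 : Type} [RCLike 𝕜] (ρ : ℝ) (h : ℝ → 𝕜) (t : ℝ) : 𝕜 :=
  deriv (rlInt (ρ - 1) h) t

/-! ### Regular solutions -/

/-- The function `h`, considered on `Ω × (0,∞)`, belongs to `C(Ω̄ × I)`: it has a continuous
extension to `Ω̄ × I`. -/
def ExtendsCont {𝕜 : Type} [RCLike 𝕜] {N : ℕ} (Ω : Set (Sp N)) (I : Set ℝ)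
    (h : Sp N → ℝ → 𝕜) : Prop :=
  ∃ H : Sp N → ℝ → 𝕜, ContinuousOn (Function.uncurry H) (closure Ω ×ˢ I) ∧
    ∀ x ∈ Ω, ∀ t > 0, H x t = h x t

/-- `u` is a regular solution of `∂_t^ρ u + A(x,D) u = f` in `Ω × (0,∞)`,
`lim_{t → 0} ∂_t^{ρ-1} u = φ` in `Ω`, `B_j u = 0` on `∂Ω × (0,∞)`. -/
structure IsRegularSolution {𝕜 : Type} [RCLike 𝕜] {N : ℕ} (Ω : Set (Sp N)) (l : ℕ)
    (a : (Fin N → ℕ) → Sp N → 𝕜) (mB : Fin l → ℕ) (b : Fin l → (Fin N → ℕ) → Sp N → 𝕜)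
    (ρ : ℝ) (f : Sp N → ℝ → 𝕜) (φ : Sp N → 𝕜) (u : Sp N → ℝ → 𝕜) : Prop where
  space_regular : ∀ t > 0, CkClosure Ω (2 * l) fun x => u x t
  integral_exists : ∀ x ∈ Ω, ∀ t > 0, RlIntExists (ρ - 1) (u x) t
  deriv_exists : ∀ x ∈ Ω, ∀ t > 0, DifferentiableAt ℝ (rlInt (ρ - 1) (u x)) t
  continuous_rlDeriv : ExtendsCont Ω (Ioi 0) fun x t => rlDeriv ρ (u x) t
  continuous_diffOp : ExtendsCont Ω (Ioi 0) fun x t => diffOp (2 * l) a (fun y => u y t) x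
  continuous_rlInt : ExtendsCont Ω (Ici 0) fun x t => rlInt (ρ - 1) (u x) t
  equation : ∀ x ∈ Ω, ∀ t > 0,
    rlDeriv ρ (u x) t + diffOp (2 * l) a (fun y => u y t) x = f x t
  initial : ∀ x ∈ Ω, Tendsto (rlInt (ρ - 1) (u x)) (𝓝[>] 0) (𝓝 (φ x))
  boundary : ∀ j, ∀ t > 0, ∀ x ∈ frontier Ω, bdryOp Ω (mB j) (b j) (fun y => u y t) x = 0

end Subdiffusion

end

noncomputable section

namespace Subdiffusion

/-! ### Linearity of the differential operators -/

section Linearity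

variable {𝕜 : Type} [RCLike 𝕜] {N : ℕ} {Ω : Set (Sp N)}

/-! By linearity (`IsRegularSolution.sub`) it suffices to show that a regular solution `u` with zero
data vanishes (`IsRegularSolution.eq_zero`). Put `H = ∂_t^{ρ-1} u` and `G = ∂_t H = ∂_t^ρ u`. The
equation says `A u = -G`, and `u(·,t) ∈ D(A)`, so `u = -T G` with the bounded inverse `T` of
condition (A). Since `T V_k = λ_k⁻¹ V_k` on a complete orthonormal system, `T` is diagonal, and the
`k`-th Fourier coefficient of `u` is `κ = -λ_k⁻¹` times that of `G`. No integration by parts is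
needed.

Let `J` be the `k`-th coefficient of `H`; it is bounded near `0` and tends to `0` there. The
semigroup law `∂_t^{-ρ} ∂_t^{ρ-1} u = ∂_t^{-1} u` (`integral_rpow_smul_rlInt`) turns the relation
between coefficients, integrated over `[ε, t]`, into `y(t) - y(ε) = κ (J(t) - J(ε))` with `y =
∂_t^{-ρ} J`. Letting `ε → 0` yields the homogeneous Abel equation `∂_t^{-ρ} J = κ J`
(`integral_mul_eq_zero`), whose only bounded solution is `0`
(`eq_zero_of_norm_le_norm_integral_rpow_smul`). Completeness gives `H = 0`, hence `G = 0` and `u =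
-T 0 = 0`.

The delicate point is Fubini's theorem: `u` is not assumed jointly continuous and may be singular at
`t = 0`. Near `0` only `H` is used; on `[ε, t]` a Carathéodory argument gives measurability, and `u
= -T G` gives the bound. -/

theorem partialD_congr (hΩ : IsOpen Ω) (i : Fin N) {f g : Sp N → 𝕜} (h : EqOn f g Ω) :
    EqOn (partialD i f) (partialD i g) Ω := fun x hx => by
  have : f =ᶠ[𝓝 x] g := h.eventuallyEq_of_mem (hΩ.mem_nhds hx)
  simp only [partialD, this.fderiv_eq]

theorem partialD_sub (hΩ : IsOpen Ω) (i : Fin N) {f g : Sp N → 𝕜}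
    (hf : ContDiffOn ℝ 1 f Ω) (hg : ContDiffOn ℝ 1 g Ω) :
    EqOn (partialD i (f - g)) (partialD i f - partialD i g) Ω := fun x hx => by
  have h1 := (hf.differentiableOn one_ne_zero).differentiableAt (hΩ.mem_nhds hx)
  have h2 := (hg.differentiableOn one_ne_zero).differentiableAt (hΩ.mem_nhds hx)
  simp [partialD, fderiv_sub h1 h2]

theorem contDiffOn_partialD (hΩ : IsOpen Ω) (i : Fin N) {n : ℕ} {f : Sp N → 𝕜}
    (hf : ContDiffOn ℝ (n + 1 : ℕ) f Ω) : ContDiffOn ℝ n (partialD i f) Ω :=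
  (hf.fderiv_of_isOpen hΩ (m := n) (by norm_cast)).clm_apply contDiffOn_const

/-- Sequences of `k` applications of `partialD i` are linear on functions of class `C^(n+k)`. -/
theorem iterate_partialD_sub (hΩ : IsOpen Ω) (i : Fin N) (n k : ℕ) :
    ∀ {f g h : Sp N → 𝕜}, ContDiffOn ℝ (n + k : ℕ) f Ω → ContDiffOn ℝ (n + k : ℕ) g Ω →
      EqOn h (f - g) Ω →
      ContDiffOn ℝ n ((partialD i)^[k] f) Ω ∧ ContDiffOn ℝ n ((partialD i)^[k] g) Ω ∧
        EqOn ((partialD i)^[k] h) ((partialD i)^[k] f - (partialD i)^[k] g) Ω := by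
  induction k with
  | zero => exact fun hf hg hh => ⟨hf, hg, hh⟩
  | succ k ih =>
    intro f g h hf hg hh
    have h1 : ∀ {f : Sp N → 𝕜}, ContDiffOn ℝ (n + (k + 1) : ℕ) f Ω → ContDiffOn ℝ 1 f Ω :=
      fun hf => hf.of_le (by norm_cast; omega)
    exact ih (contDiffOn_partialD hΩ i hf) (contDiffOn_partialD hΩ i hg)
      ((partialD_congr hΩ i hh).trans (partialD_sub hΩ i (h1 hf) (h1 hg)))

/-- Each differentiation spends one order of smoothness, so the induction must carry the remaining
order `n` along with the subtraction rule. -/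
theorem foldr_partialD_sub (hΩ : IsOpen Ω) (α : Fin N → ℕ) {f g : Sp N → 𝕜} (L : List (Fin N)) :
    ∀ n : ℕ, ContDiffOn ℝ (n + (L.map α).sum : ℕ) f Ω → ContDiffOn ℝ (n + (L.map α).sum : ℕ) g Ω →
      ContDiffOn ℝ n (L.foldr (fun i h => (partialD i)^[α i] h) f) Ω ∧
      ContDiffOn ℝ n (L.foldr (fun i h => (partialD i)^[α i] h) g) Ω ∧
      EqOn (L.foldr (fun i h => (partialD i)^[α i] h) (f - g))
        (L.foldr (fun i h => (partialD i)^[α i] h) f -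
          L.foldr (fun i h => (partialD i)^[α i] h) g) Ω := by
  induction L with
  | nil => exact fun n hf hg => ⟨by simpa using hf, by simpa using hg, fun x _ => rfl⟩
  | cons i L ih =>
    intro n hf hg
    simp only [List.map_cons, List.sum_cons, ← add_assoc] at hf hg
    obtain ⟨h1, h2, h3⟩ := ih (n + α i) hf hg
    exact iterate_partialD_sub hΩ i n (α i) h1 h2 h3

theorem sum_le_of_mem_multiIdx {k : ℕ} {α : Fin N → ℕ} (h : α ∈ multiIdx N k) :
    ∑ i, α i ≤ k := (Finset.mem_filter.1 h).2

theorem multiIdx_mono {j k : ℕ} (h : j ≤ k) : multiIdx N j ⊆ multiIdx N k := by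
  intro α hα
  simp only [multiIdx, Finset.mem_filter, Fintype.mem_piFinset, Finset.mem_range] at hα ⊢
  exact ⟨fun i => (hα.1 i).trans_le (by omega), hα.2.trans h⟩

theorem multiD_sub (hΩ : IsOpen Ω) {k : ℕ} {α : Fin N → ℕ} (hα : α ∈ multiIdx N k)
    {f g : Sp N → 𝕜} (hf : ContDiffOn ℝ k f Ω) (hg : ContDiffOn ℝ k g Ω) :
    EqOn (multiD α (f - g)) (multiD α f - multiD α g) Ω := by
  have h : 0 + ((List.finRange N).map α).sum ≤ k := by
    rw [← List.ofFn_eq_map, List.sum_ofFn, zero_add]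
    exact sum_le_of_mem_multiIdx hα
  exact (foldr_partialD_sub hΩ α (List.finRange N) 0 (hf.of_le (by exact_mod_cast h))
    (hg.of_le (by exact_mod_cast h))).2.2

theorem diffOp_sub (hΩ : IsOpen Ω) {m : ℕ} (a : (Fin N → ℕ) → Sp N → 𝕜)
    {f g : Sp N → 𝕜} (hf : ContDiffOn ℝ m f Ω) (hg : ContDiffOn ℝ m g Ω) :
    EqOn (diffOp m a (f - g)) (diffOp m a f - diffOp m a g) Ω := fun x hx => by
  simp only [diffOp, Pi.sub_apply, ← Finset.sum_sub_distrib]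
  refine Finset.sum_congr rfl fun α hα => ?_
  rw [multiD_sub hΩ hα hf hg hx, Pi.sub_apply, mul_sub]

theorem CkClosure.sub (hΩ : IsOpen Ω) {k : ℕ} {f g : Sp N → 𝕜} (hf : CkClosure Ω k f)
    (hg : CkClosure Ω k g) : CkClosure Ω k (f - g) := by
  refine ⟨hf.1.sub hg.1, hf.2.1.sub hg.2.1, fun α hα => ?_⟩
  obtain ⟨F, hF, hF'⟩ := hf.2.2 α hα
  obtain ⟨G, hG, hG'⟩ := hg.2.2 α hα
  refine ⟨F - G, hF.sub hG, fun x hx => ?_⟩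
  rw [multiD_sub hΩ hα hf.1 hg.1 hx, Pi.sub_apply, Pi.sub_apply, hF' hx, hG' hx]

theorem CkClosure.exists_tendsto_multiD {k : ℕ} {f : Sp N → 𝕜} (hf : CkClosure Ω k f)
    {α : Fin N → ℕ} (hα : α ∈ multiIdx N k) {x : Sp N} (hx : x ∈ closure Ω) :
    ∃ y, Tendsto (multiD α f) (𝓝[Ω] x) (𝓝 y) := by
  obtain ⟨F, hF, hF'⟩ := hf.2.2 α hα
  exact ⟨F x, ((hF x hx).mono subset_closure).tendsto.congr'
    (hF'.eventuallyEq_of_mem self_mem_nhdsWithin)⟩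

/-- `extendFrom` is additive only where the limits exist; `j ≤ k` ensures that every derivative in
the boundary operator has a limit from inside. -/
theorem bdryOp_sub (hΩ : IsOpen Ω) {j k : ℕ} (hjk : j ≤ k) (b : (Fin N → ℕ) → Sp N → 𝕜)
    {f g : Sp N → 𝕜} (hf : CkClosure Ω k f) (hg : CkClosure Ω k g) :
    EqOn (bdryOp Ω j b (f - g)) (bdryOp Ω j b f - bdryOp Ω j b g) (frontier Ω) := fun x hx => by
  have hx' := frontier_subset_closure hx
  simp only [bdryOp, Pi.sub_apply, ← Finset.sum_sub_distrib]
  refine Finset.sum_congr rfl fun α hα => ?_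
  have hα' := multiIdx_mono hjk hα
  obtain ⟨y, hy⟩ := hf.exists_tendsto_multiD hα' hx'
  obtain ⟨z, hz⟩ := hg.exists_tendsto_multiD hα' hx'
  have h : Tendsto (multiD α (f - g)) (𝓝[Ω] x) (𝓝 (y - z)) :=
    (hy.sub hz).congr' ((multiD_sub hΩ hα' hf.1 hg.1).symm.eventuallyEq_of_mem self_mem_nhdsWithin)
  rw [extendFrom_eq hx' h, extendFrom_eq hx' hy, extendFrom_eq hx' hz, mul_sub]

end Linearity

/-! ### Differences of regular solutions -/

section Difference

variable {𝕜 : Type} [RCLike 𝕜]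

theorem rlInt_sub {s t : ℝ} {g h : ℝ → 𝕜} (hg : RlIntExists s g t) (hh : RlIntExists s h t) :
    rlInt s (g - h) t = rlInt s g t - rlInt s h t := by
  unfold rlInt
  split_ifs with hs
  · rfl
  · simp only [Pi.sub_apply, smul_sub]
    rw [intervalIntegral.integral_sub (hg hs) (hh hs), smul_sub]

theorem RlIntExists.sub {s t : ℝ} {g h : ℝ → 𝕜} (hg : RlIntExists s g t)
    (hh : RlIntExists s h t) : RlIntExists s (g - h) t := fun hs => by
  simpa only [Pi.sub_apply, smul_sub] using (hg hs).sub (hh hs)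

theorem ExtendsCont.sub {N : ℕ} {Ω : Set (Sp N)} {I : Set ℝ} {g h k : Sp N → ℝ → 𝕜}
    (hg : ExtendsCont Ω I g) (hh : ExtendsCont Ω I h)
    (hk : ∀ x ∈ Ω, ∀ t > 0, k x t = g x t - h x t) : ExtendsCont Ω I k := by
  obtain ⟨G, hG, hG'⟩ := hg
  obtain ⟨H, hH, hH'⟩ := hh
  refine ⟨fun x t => G x t - H x t, hG.sub hH, fun x hx t ht => ?_⟩
  rw [hk x hx t ht, ← hG' x hx t ht, ← hH' x hx t ht]

theorem IsRegularSolution.sub {N : ℕ} {Ω : Set (Sp N)} (hΩ : IsOpen Ω) {l : ℕ}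
    {a : (Fin N → ℕ) → Sp N → 𝕜} {mB : Fin l → ℕ} (hmB : ∀ j, mB j ≤ 2 * l)
    {b : Fin l → (Fin N → ℕ) → Sp N → 𝕜} {ρ : ℝ} {f : Sp N → ℝ → 𝕜} {φ : Sp N → 𝕜}
    {u v : Sp N → ℝ → 𝕜} (hu : IsRegularSolution Ω l a mB b ρ f φ u)
    (hv : IsRegularSolution Ω l a mB b ρ f φ v) :
    IsRegularSolution Ω l a mB b ρ 0 0 (u - v) := by
  have hint : ∀ x ∈ Ω, ∀ t > 0,
      rlInt (ρ - 1) ((u - v) x) t = rlInt (ρ - 1) (u x) t - rlInt (ρ - 1) (v x) t :=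
    fun x hx t ht => rlInt_sub (hu.integral_exists x hx t ht) (hv.integral_exists x hx t ht)
  -- Linearity is available only for positive times, where the integrals exist; this is enough for
  -- derivatives because it holds near each `t > 0`.
  have hint' : ∀ x ∈ Ω, ∀ t > 0,
      rlInt (ρ - 1) ((u - v) x) =ᶠ[𝓝 t] rlInt (ρ - 1) (u x) - rlInt (ρ - 1) (v x) :=
    fun x hx t ht => by
      filter_upwards [Ioi_mem_nhds ht] with s hs using hint x hx s hs
  have hder : ∀ x ∈ Ω, ∀ t > 0,
      rlDeriv ρ ((u - v) x) t = rlDeriv ρ (u x) t - rlDeriv ρ (v x) t := fun x hx t ht => by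
    simp only [rlDeriv]
    rw [(hint' x hx t ht).deriv_eq,
      deriv_sub (hu.deriv_exists x hx t ht) (hv.deriv_exists x hx t ht)]
  have hop : ∀ x ∈ Ω, ∀ t > 0, diffOp (2 * l) a (fun y => (u - v) y t) x =
      diffOp (2 * l) a (fun y => u y t) x - diffOp (2 * l) a (fun y => v y t) x :=
    fun x hx t ht => diffOp_sub hΩ a (hu.space_regular t ht).1 (hv.space_regular t ht).1 hx
  exact
  { space_regular := fun t ht => (hu.space_regular t ht).sub hΩ (hv.space_regular t ht)
    integral_exists := fun x hx t ht =>
      (hu.integral_exists x hx t ht).sub (hv.integral_exists x hx t ht)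
    deriv_exists := fun x hx t ht =>
      ((hu.deriv_exists x hx t ht).sub (hv.deriv_exists x hx t ht)).congr_of_eventuallyEq
        (hint' x hx t ht)
    continuous_rlDeriv := hu.continuous_rlDeriv.sub hv.continuous_rlDeriv hder
    continuous_diffOp := hu.continuous_diffOp.sub hv.continuous_diffOp hop
    continuous_rlInt := hu.continuous_rlInt.sub hv.continuous_rlInt hint
    equation := fun x hx t ht => by
      rw [hder x hx t ht, hop x hx t ht, sub_add_sub_comm, hu.equation x hx t ht,
        hv.equation x hx t ht, sub_self]
      rfl
    initial := fun x hx => by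
      have := (hu.initial x hx).sub (hv.initial x hx)
      rw [sub_self] at this
      refine this.congr' ?_
      filter_upwards [self_mem_nhdsWithin] with t ht using (hint x hx t ht).symm
    boundary := fun j t ht x hx => by
      have := bdryOp_sub hΩ (hmB j) (b j) (hu.space_regular t ht) (hv.space_regular t ht) hx
      rw [Pi.sub_apply, hu.boundary j t ht x hx, hv.boundary j t ht x hx, sub_self] at this
      exact this }

end Difference

/-! ### Riemann–Liouville integrals -/

section RiemannLiouville

/-- After a shift this is the scaled Beta integral `B(1-ρ, ρ)`. The two parameters add up to `1`, so
the power of `t - r` disappears and `Γ(1) = 1` is the denominator. -/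
theorem integral_beta_kernel {ρ r t : ℝ} (h0 : 0 < ρ) (h1 : ρ < 1) (hrt : r < t) :
    ∫ s in r..t, (t - s) ^ (ρ - 1) * (s - r) ^ (-ρ) = Real.Gamma ρ * Real.Gamma (1 - ρ) := by
  have ha : 0 < t - r := sub_pos.2 hrt
  have e1 : ∫ s in r..t, (t - s) ^ (ρ - 1) * (s - r) ^ (-ρ) =
      ∫ x in (0 : ℝ)..(t - r), x ^ (-ρ) * ((t - r) - x) ^ (ρ - 1) := by
    have := intervalIntegral.integral_comp_sub_right (a := r) (b := t)
      (fun x : ℝ => x ^ (-ρ) * ((t - r) - x) ^ (ρ - 1)) r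
    rw [sub_self] at this
    rw [← this]
    refine intervalIntegral.integral_congr fun s _ => ?_
    rw [mul_comm, show t - r - (s - r) = t - s by ring]
  have e2 := Complex.betaIntegral_scaled ((1 - ρ : ℝ) : ℂ) (ρ : ℂ) ha
  have e3 := Complex.Gamma_mul_Gamma_eq_betaIntegral (s := ((1 - ρ : ℝ) : ℂ)) (t := (ρ : ℂ))
    (by simpa using h1) (by simpa using h0)
  have e4 : ((1 - ρ : ℝ) : ℂ) + ρ = 1 := by push_cast; ring
  rw [e4, Complex.Gamma_one, one_mul] at e3
  rw [e4, sub_self, Complex.cpow_zero, one_mul, ← e3, Complex.Gamma_ofReal,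
    Complex.Gamma_ofReal] at e2
  have e5 : ∫ x in (0 : ℝ)..(t - r), (x : ℂ) ^ (((1 - ρ : ℝ) : ℂ) - 1) *
      (((t - r : ℝ) : ℂ) - x) ^ ((ρ : ℂ) - 1) =
      ∫ x in (0 : ℝ)..(t - r), ((x ^ (-ρ) * ((t - r) - x) ^ (ρ - 1) : ℝ) : ℂ) := by
    refine intervalIntegral.integral_congr fun x hx => ?_
    rw [uIcc_of_le ha.le] at hx
    rw [Complex.ofReal_mul, Complex.ofReal_cpow hx.1, Complex.ofReal_cpow (sub_nonneg.2 hx.2)]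
    congr 2 <;> push_cast <;> ring
  rw [e5, intervalIntegral.integral_ofReal] at e2
  rw [e1, mul_comm (Real.Gamma ρ)]
  exact_mod_cast e2

/-- A non-integrable function has integral `0` by convention, whereas this integral is positive. -/
theorem intervalIntegrable_beta_kernel {ρ r t : ℝ} (h0 : 0 < ρ) (h1 : ρ < 1) (hrt : r < t) :
    IntervalIntegrable (fun s => (t - s) ^ (ρ - 1) * (s - r) ^ (-ρ)) volume r t := by
  by_contra h
  have := integral_beta_kernel h0 h1 hrt
  rw [intervalIntegral.integral_undef h] at this
  exact (mul_pos (Real.Gamma_pos_of_pos h0) (Real.Gamma_pos_of_pos (sub_pos.2 h1))).ne this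

variable {𝕜 : Type} [RCLike 𝕜]

/-- Multiplying by the continuous function `(t - ξ)^ρ` cancels the weight on the open interval. -/
theorem intervalIntegrable_of_rpow_smul {ρ t : ℝ} (h0 : 0 < ρ) (ht : 0 < t) {h : ℝ → 𝕜}
    (hh : IntervalIntegrable (fun ξ => ((t - ξ) ^ (-ρ) : ℝ) • h ξ) volume 0 t) :
    IntervalIntegrable h volume 0 t := by
  have hc : ContinuousOn (fun ξ : ℝ => (t - ξ) ^ ρ) (uIcc 0 t) :=
    ((continuous_const.sub continuous_id).rpow_const fun _ => Or.inr h0.le).continuousOn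
  have := hh.continuousOn_smul hc
  rw [intervalIntegrable_iff_integrableOn_Ioo_of_le ht.le] at this ⊢
  refine this.congr_fun (fun ξ hξ => ?_) measurableSet_Ioo
  have hp : 0 < t - ξ := sub_pos.2 hξ.2
  simp only
  rw [smul_smul, ← Real.rpow_add hp, add_neg_cancel, Real.rpow_zero, one_smul]

/-- Interchanging the two Riemann–Liouville integrals `∂_t^{-ρ} ∂_t^{ρ-1} h`. -/
theorem integral_rpow_smul_integral_rpow_smul {ρ t : ℝ} (h0 : 0 < ρ) (h1 : ρ < 1) (ht : 0 < t)
    {h : ℝ → 𝕜} (hh : IntervalIntegrable h volume 0 t) :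
    ∫ s in (0 : ℝ)..t, ((t - s) ^ (ρ - 1) : ℝ) • ∫ r in (0 : ℝ)..s, ((s - r) ^ (-ρ) : ℝ) • h r =
      (Real.Gamma ρ * Real.Gamma (1 - ρ)) • ∫ r in (0 : ℝ)..t, h r := by
  set ν : Measure ℝ := volume.restrict (Ioc 0 t) with hν
  set k : ℝ → ℝ → ℝ := fun r s => (t - s) ^ (ρ - 1) * (s - r) ^ (-ρ) with hk
  -- The kernel is cut off to the triangle `r < s`, so that Fubini's theorem applies on the whole
  -- square.
  set K : ℝ → ℝ → ℝ := fun r s => {p : ℝ × ℝ | p.1 < p.2}.indicator (fun p => k p.1 p.2) (r, s)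
    with hK
  have hKm : Measurable (Function.uncurry K) := by
    refine Measurable.indicator ?_ (measurableSet_lt measurable_fst measurable_snd)
    simp only [hk]
    fun_prop
  have hK1 : ∀ r, K r = (Ioi r).indicator (k r) := fun r => by
    ext s; simp [hK, indicator]
  have hKi : ∀ r ∈ Ioo 0 t, Integrable (K r) ν ∧
      ∫ s, K r s ∂ν = Real.Gamma ρ * Real.Gamma (1 - ρ) := fun r hr => by
    have hset : Ioc 0 t ∩ Ioi r = Ioc r t := by
      ext s; simp only [mem_inter_iff, mem_Ioc, mem_Ioi]
      exact ⟨fun h => ⟨h.2, h.1.2⟩, fun h => ⟨⟨hr.1.trans h.1, h.2⟩, h.1⟩⟩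
    constructor
    · rw [hK1, integrable_indicator_iff measurableSet_Ioi, IntegrableOn, hν,
        Measure.restrict_restrict measurableSet_Ioi, inter_comm, hset]
      exact (intervalIntegrable_beta_kernel h0 h1 hr.2).1
    · rw [hK1, integral_indicator measurableSet_Ioi, hν,
        Measure.restrict_restrict measurableSet_Ioi, inter_comm, hset,
        ← intervalIntegral.integral_of_le hr.2.le]
      exact integral_beta_kernel h0 h1 hr.2
  have hKn : ∀ r s, s ≤ t → 0 ≤ K r s := fun r s hs => by
    simp only [hK, hk]
    refine indicator_apply_nonneg fun hp => ?_
    have hp : r < s := hp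
    exact mul_nonneg (Real.rpow_nonneg (sub_nonneg.2 hs) _) (Real.rpow_nonneg (sub_pos.2 hp).le _)
  have hmem : ∀ᵐ r ∂ν, r ∈ Ioo 0 t := by
    rw [hν, ← restrict_Ioo_eq_restrict_Ioc]
    exact ae_restrict_mem measurableSet_Ioo
  have hhν : Integrable h ν := hh.1
  have hint : Integrable (Function.uncurry fun r s => K r s • h r) (ν.prod ν) := by
    have hm : AEStronglyMeasurable (Function.uncurry fun r s => K r s • h r) (ν.prod ν) :=
      (hKm.aestronglyMeasurable (μ := ν.prod ν)).smul
        (hhν.aestronglyMeasurable.comp_fst (ν := ν))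
    refine (integrable_prod_iff hm).2 ⟨?_, ?_⟩
    · filter_upwards [hmem] with r hr using (hKi r hr).1.smul_const (h r)
    -- The kernel is nonnegative with the same mass `Γ(ρ)Γ(1-ρ)` for every `r`, so the inner
    -- integral of the norm is a constant times `‖h r‖`.
    · refine (hhν.norm.const_mul (Real.Gamma ρ * Real.Gamma (1 - ρ))).congr ?_
      filter_upwards [hmem] with r hr
      have : ∫ s, ‖K r s • h r‖ ∂ν = ∫ s, K r s * ‖h r‖ ∂ν := by
        refine integral_congr_ae ?_
        filter_upwards [hmem] with s hs
        rw [norm_smul, Real.norm_of_nonneg (hKn r s hs.2.le)]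
      simp only [Function.uncurry]
      rw [this, integral_mul_const, (hKi r hr).2]
  have hswap := integral_integral_swap hint
  rw [intervalIntegral.integral_of_le ht.le, intervalIntegral.integral_of_le ht.le,
    ← integral_smul]
  have e1 : ∫ r, ∫ s, K r s • h r ∂ν ∂ν =
      ∫ r, (Real.Gamma ρ * Real.Gamma (1 - ρ)) • h r ∂ν := by
    refine integral_congr_ae ?_
    filter_upwards [hmem] with r hr
    rw [integral_smul_const, (hKi r hr).2]
  rw [← e1, hswap]
  refine integral_congr_ae ?_
  filter_upwards [hmem] with s hs
  have hset : Ioc 0 t ∩ Iio s = Ioo 0 s := by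
    ext r; simp only [mem_inter_iff, mem_Ioc, mem_Ioo, mem_Iio]
    exact ⟨fun h => ⟨h.1.1, h.2⟩, fun h => ⟨⟨h.1, (h.2.trans hs.2).le⟩, h.2⟩⟩
  have e2 : (fun r => K r s • h r) = (Iio s).indicator fun r => k r s • h r := by
    ext r
    simp only [hK, indicator, mem_ofPred_eq, mem_Iio]
    split_ifs <;> simp
  rw [e2, integral_indicator measurableSet_Iio, hν,
    Measure.restrict_restrict measurableSet_Iio, inter_comm, hset,
    intervalIntegral.integral_of_le hs.1.le, integral_Ioc_eq_integral_Ioo, ← integral_smul]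
  simp only [hk, mul_smul]

/-- `∂_t^{-ρ} ∂_t^{ρ-1} h = ∂_t^{-1} h` for `0 < ρ < 1`. -/
theorem integral_rpow_smul_rlInt {ρ t : ℝ} (h0 : 0 < ρ) (h1 : ρ < 1) (ht : 0 < t) {h : ℝ → 𝕜}
    (hh : IntervalIntegrable h volume 0 t) :
    (Real.Gamma ρ)⁻¹ • ∫ s in (0 : ℝ)..t, ((t - s) ^ (ρ - 1) : ℝ) • rlInt (ρ - 1) h s =
      ∫ s in (0 : ℝ)..t, h s := by
  have hne : ρ - 1 ≠ 0 := by linarith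
  have hG := (Real.Gamma_pos_of_pos h0).ne'
  have hG' := (Real.Gamma_pos_of_pos (sub_pos.2 h1)).ne'
  have e : ∀ s, rlInt (ρ - 1) h s =
      (Real.Gamma (1 - ρ))⁻¹ • ∫ r in (0 : ℝ)..s, ((s - r) ^ (-ρ) : ℝ) • h r := fun s => by
    rw [rlInt, if_neg hne, show -(ρ - 1) = 1 - ρ by ring, show 1 - ρ - 1 = -ρ by ring]
  simp only [e, smul_comm _ (Real.Gamma (1 - ρ))⁻¹]
  rw [intervalIntegral.integral_smul, integral_rpow_smul_integral_rpow_smul h0 h1 ht hh, smul_smul,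
    smul_smul, show (Real.Gamma ρ)⁻¹ * (Real.Gamma (1 - ρ))⁻¹ *
      (Real.Gamma ρ * Real.Gamma (1 - ρ)) = 1 by field_simp, one_smul]

end RiemannLiouville

/-! ### A weakly singular Volterra inequality -/

theorem integrableOn_rpow_mul_exp_neg_mul {ρ β : ℝ} (h0 : 0 < ρ) (hβ : 0 < β) :
    IntegrableOn (fun r : ℝ => r ^ (ρ - 1) * Real.exp (-(β * r))) (Ioi 0) := by
  by_contra h
  have := Real.integral_rpow_mul_exp_neg_mul_Ioi h0 hβ
  rw [integral_undef h] at this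
  have := Real.Gamma_pos_of_pos h0
  have : 0 < (1 / β) ^ ρ * Real.Gamma ρ := by positivity
  linarith

/-- Writing `e^{βs} = e^{-β(t-s)} e^{βt}` moves the weight into the kernel, whose mass on the
half-line is `β^{-ρ} Γ(ρ)`. In the weighted sup norm the fractional integral is therefore as small
as desired for large `β`. -/
theorem norm_integral_rpow_smul_le_of_exp {E : Type*} [NormedAddCommGroup E] [NormedSpace ℝ E]
    {ρ β D t : ℝ} (h0 : 0 < ρ) (hβ : 0 < β) (hD : 0 ≤ D) (ht : 0 < t) {J : ℝ → E}
    (hJ : ∀ s ∈ Ioc 0 t, ‖J s‖ ≤ D * Real.exp (β * s)) :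
    ‖∫ s in (0 : ℝ)..t, ((t - s) ^ (ρ - 1) : ℝ) • J s‖ ≤
      (1 / β) ^ ρ * Real.Gamma ρ * (D * Real.exp (β * t)) := by
  set k : ℝ → ℝ := fun r => r ^ (ρ - 1) * Real.exp (-(β * r)) with hk
  have hki := integrableOn_rpow_mul_exp_neg_mul h0 hβ
  have hki' : IntervalIntegrable k volume 0 t :=
    (intervalIntegrable_iff_integrableOn_Ioc_of_le ht.le).2 (hki.mono_set Ioc_subset_Ioi_self)
  have hki'' : IntervalIntegrable (fun s => k (t - s)) volume 0 t := by
    simpa using (hki'.comp_sub_left t).symm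
  have hint : ∫ s in (0 : ℝ)..t, k (t - s) ≤ (1 / β) ^ ρ * Real.Gamma ρ := by
    rw [intervalIntegral.integral_comp_sub_left, sub_self, sub_zero,
      ← Real.integral_rpow_mul_exp_neg_mul_Ioi h0 hβ, intervalIntegral.integral_of_le ht.le]
    refine setIntegral_mono_set hki ?_ Ioc_subset_Ioi_self.eventuallyLE
    filter_upwards [ae_restrict_mem measurableSet_Ioi] with r hr
    exact mul_nonneg (Real.rpow_nonneg (le_of_lt hr) _) (Real.exp_pos _).le
  calc ‖∫ s in (0 : ℝ)..t, ((t - s) ^ (ρ - 1) : ℝ) • J s‖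
      ≤ ∫ s in (0 : ℝ)..t, k (t - s) * (D * Real.exp (β * t)) := by
        refine intervalIntegral.norm_integral_le_of_norm_le ht.le
          (Eventually.of_forall fun s hs => ?_) (hki''.mul_const _)
        have hs' : 0 ≤ (t - s) ^ (ρ - 1) := Real.rpow_nonneg (sub_nonneg.2 hs.2) _
        rw [norm_smul, Real.norm_of_nonneg hs', hk]
        simp only
        have : Real.exp (β * s) = Real.exp (-(β * (t - s))) * Real.exp (β * t) := by
          rw [← Real.exp_add]; congr 1; ring
        calc _ ≤ (t - s) ^ (ρ - 1) * (D * Real.exp (β * s)) := by gcongr; exact hJ s hs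
          _ = _ := by rw [this]; ring
    _ ≤ _ := by
        rw [intervalIntegral.integral_mul_const]
        gcongr

/-- A bounded function that is dominated by a multiple of its own Riemann–Liouville integral
vanishes. -/
theorem eq_zero_of_norm_le_norm_integral_rpow_smul {E : Type*} [NormedAddCommGroup E]
    [NormedSpace ℝ E] {ρ c R : ℝ} (h0 : 0 < ρ) (hc : 0 ≤ c) {J : ℝ → E}
    (hb : ∃ C, ∀ t ∈ Ioc 0 R, ‖J t‖ ≤ C)
    (hJ : ∀ t ∈ Ioc 0 R, ‖J t‖ ≤ c * ‖∫ s in (0 : ℝ)..t, ((t - s) ^ (ρ - 1) : ℝ) • J s‖) :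
    ∀ t ∈ Ioc 0 R, J t = 0 := by
  obtain ⟨C, hC⟩ := hb
  have hΓ := Real.Gamma_pos_of_pos h0
  -- `q` is the target for `β^{-ρ}`, chosen so that `c q Γ(ρ) ≤ 1/2`; the `+ 1` keeps the
  -- denominator positive when `c = 0`.
  set q : ℝ := 1 / (2 * (c * Real.Gamma ρ + 1)) with hq
  have hq0 : 0 < q := by positivity
  set β : ℝ := (q ^ ρ⁻¹)⁻¹ with hβ
  have hβ0 : 0 < β := by positivity
  have hβq : (1 / β) ^ ρ = q := by
    rw [hβ, one_div, inv_inv, ← Real.rpow_mul hq0.le, inv_mul_cancel₀ h0.ne', Real.rpow_one]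
  have hcq : c * (q * Real.Gamma ρ) ≤ 1 / 2 := by
    rw [hq]
    field_simp
    linarith
  -- Every use of the inequality halves the bound in the norm weighted by `e^{βt}`.
  have key : ∀ n : ℕ, ∀ t ∈ Ioc 0 R, ‖J t‖ ≤ |C| * (1 / 2) ^ n * Real.exp (β * t) := by
    intro n
    induction n with
    | zero =>
      intro t ht
      have : 1 ≤ Real.exp (β * t) := Real.one_le_exp (mul_nonneg hβ0.le ht.1.le)
      calc ‖J t‖ ≤ |C| := (hC t ht).trans (le_abs_self C)
        _ ≤ _ := by rw [pow_zero, mul_one]; exact le_mul_of_one_le_right (abs_nonneg C) this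
    | succ n ih =>
      intro t ht
      have h := norm_integral_rpow_smul_le_of_exp h0 hβ0 (D := |C| * (1 / 2) ^ n)
        (by positivity) ht.1 (J := J) fun s hs => ih s ⟨hs.1, hs.2.trans ht.2⟩
      rw [hβq] at h
      calc ‖J t‖ ≤ c * (q * Real.Gamma ρ * (|C| * (1 / 2) ^ n * Real.exp (β * t))) :=
            (hJ t ht).trans (by gcongr)
        _ = c * (q * Real.Gamma ρ) * (|C| * (1 / 2) ^ n * Real.exp (β * t)) := by ring
        _ ≤ 1 / 2 * (|C| * (1 / 2) ^ n * Real.exp (β * t)) := by gcongr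
        _ = _ := by rw [pow_succ]; ring
  intro t ht
  have hlim : Tendsto (fun n : ℕ => |C| * (1 / 2 : ℝ) ^ n * Real.exp (β * t)) atTop (𝓝 0) := by
    have := ((tendsto_pow_atTop_nhds_zero_of_lt_one (r := (1 / 2 : ℝ)) (by norm_num)
      (by norm_num)).const_mul |C|).mul_const (Real.exp (β * t))
    simpa using this
  exact norm_le_zero_iff.1 (ge_of_tendsto' hlim fun n => key n t ht)

/-! ### Measurability of Carathéodory functions and Fubini's theorem -/

section Fubini

/-- A function that is continuous in the first and a.e. measurable in the second variable is
a.e. measurable. -/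
theorem aestronglyMeasurable_uncurry_of_continuous {X α β : Type*} [TopologicalSpace X]
    [TopologicalSpace.MetrizableSpace X] [SecondCountableTopology X] [MeasurableSpace X]
    [OpensMeasurableSpace X] [MeasurableSpace α] [TopologicalSpace β] [Zero β]
    [TopologicalSpace.PseudoMetrizableSpace β] {μ : Measure X} {ν : Measure α}
    {F : X → α → β} (hc : ∀ᵐ s ∂ν, Continuous fun x => F x s)
    (hm : ∀ x, AEStronglyMeasurable (F x) ν) :
    AEStronglyMeasurable (Function.uncurry F) (μ.prod ν) := by
  obtain ⟨D, hD, hDd⟩ := TopologicalSpace.exists_countable_dense X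
  have hae : ∀ᵐ s ∂ν, (Continuous fun x => F x s) ∧ ∀ d ∈ D, F d s = (hm d).mk _ s :=
    hc.and ((ae_ball_iff hD).2 fun d _ => (hm d).ae_eq_mk)
  -- Countability of `D` puts all exceptional times into one measurable null set `Z`. Setting `F` to
  -- `0` there makes the sections over `D` strongly measurable, hence all sections as pointwise
  -- limits.
  obtain ⟨Z, hZs, hZm, hZ⟩ := exists_measurable_superset_of_null hae
  have hgood : ∀ s ∉ Z, (Continuous fun x => F x s) ∧ ∀ d ∈ D, F d s = (hm d).mk _ s :=
    fun s hs => by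
      by_contra h
      exact hs (hZs h)
  set F' : X → α → β := fun x => Zᶜ.indicator (F x) with hF'
  have hcont : ∀ s, Continuous fun x => F' x s := fun s => by
    by_cases hs : s ∈ Z
    · have : (fun x => F' x s) = fun _ => 0 := by ext x; simp [hF', hs]
      rw [this]
      exact continuous_const
    · have : (fun x => F' x s) = fun x => F x s := by ext x; simp [hF', hs]
      rw [this]
      exact (hgood s hs).1
  have hmeasD : ∀ d ∈ D, StronglyMeasurable (F' d) := fun d hd => by
    have : F' d = Zᶜ.indicator ((hm d).mk _) := by
      ext s
      by_cases hs : s ∈ Z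
      · simp [hF', hs]
      · simp [hF', hs, (hgood s hs).2 d hd]
    rw [this]
    exact (hm d).stronglyMeasurable_mk.indicator hZm.compl
  have hmeas : ∀ x, StronglyMeasurable (F' x) := fun x => by
    obtain ⟨d, hd, hdx⟩ := mem_closure_iff_seq_limit.1 (hDd x)
    exact stronglyMeasurable_of_tendsto atTop (fun n => hmeasD (d n) (hd n))
      (tendsto_pi_nhds.2 fun s => ((hcont s).tendsto x).comp hdx)
  refine (stronglyMeasurable_uncurry_of_continuous_of_stronglyMeasurable hcont
    hmeas).aestronglyMeasurable.congr ?_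
  have hZ' : ∀ᵐ s ∂ν, s ∉ Z := measure_eq_zero_iff_ae_notMem.1 hZ
  filter_upwards [Measure.quasiMeasurePreserving_snd.ae hZ'] with p hp
  simp [Function.uncurry, hF', hp]

variable {𝕜 : Type} [RCLike 𝕜] {N : ℕ} {Ω : Set (Sp N)}

/-- Continuity holds only on `Ω`, so the Carathéodory criterion is applied on the subtype and
transported along the embedding. -/
theorem aestronglyMeasurable_uncurry_of_continuousOn (hΩ : MeasurableSet Ω)
    (hb : Bornology.IsBounded Ω) {ν : Measure ℝ} [SFinite ν] {u : Sp N → ℝ → 𝕜}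
    (hc : ∀ᵐ s ∂ν, ContinuousOn (fun x => u x s) Ω)
    (hm : ∀ x ∈ Ω, AEStronglyMeasurable (u x) ν) :
    AEStronglyMeasurable (Function.uncurry u) ((volume.restrict Ω).prod ν) := by
  have : IsFiniteMeasure (Measure.comap (Subtype.val : Ω → Sp N) volume) := ⟨by
    rw [comap_subtype_coe_apply hΩ, image_univ, Subtype.range_coe]
    exact hb.measure_lt_top⟩
  have he : MeasurableEmbedding (Prod.map (Subtype.val : Ω → Sp N) (id : ℝ → ℝ)) :=
    (MeasurableEmbedding.subtype_coe hΩ).prodMap MeasurableEmbedding.id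
  have hmap : (volume.restrict Ω).prod ν = Measure.map (Prod.map (Subtype.val : Ω → Sp N) id)
      ((Measure.comap (Subtype.val : Ω → Sp N) volume).prod ν) := by
    rw [← Measure.map_prod_map _ _ measurable_subtype_coe measurable_id, Measure.map_id,
      map_comap_subtype_coe hΩ]
  rw [hmap, he.aestronglyMeasurable_map_iff]
  refine aestronglyMeasurable_uncurry_of_continuous (F := fun (x : Ω) s => u x s) ?_
    fun x => hm x x.2
  filter_upwards [hc] with s hs using hs.domRestrict

theorem isFiniteMeasure_restrict_of_isBounded (hb : Bornology.IsBounded Ω) :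
    IsFiniteMeasure (volume.restrict Ω) :=
  ⟨by rw [Measure.restrict_apply_univ]; exact hb.measure_lt_top⟩

theorem exists_norm_le_of_continuousOn_closure (hb : Bornology.IsBounded Ω) {g : Sp N → 𝕜}
    (hg : ContinuousOn g (closure Ω)) : ∃ C, ∀ x ∈ closure Ω, ‖g x‖ ≤ C :=
  hb.isCompact_closure.exists_bound_of_continuousOn hg

theorem memLp_of_continuousOn_closure (hΩ : MeasurableSet Ω) (hb : Bornology.IsBounded Ω)
    {g : Sp N → 𝕜} (hg : ContinuousOn g (closure Ω)) (p : ENNReal) :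
    MemLp g p (volume.restrict Ω) := by
  have := isFiniteMeasure_restrict_of_isBounded hb
  obtain ⟨C, hC⟩ := exists_norm_le_of_continuousOn_closure hb hg
  refine MemLp.of_bound ((hg.mono subset_closure).aestronglyMeasurable hΩ) C ?_
  filter_upwards [ae_restrict_mem hΩ] with x hx using hC x (subset_closure hx)

theorem integrable_smul_prod (hΩ : MeasurableSet Ω) (hb : Bornology.IsBounded Ω) {a b : ℝ}
    {Φ : ℝ → Sp N → 𝕜} (hΦ : ContinuousOn (Function.uncurry Φ) (Icc a b ×ˢ closure Ω))
    {k : ℝ → ℝ} (hk : IntegrableOn k (Ioc a b)) :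
    Integrable (Function.uncurry fun s x => k s • Φ s x)
      ((volume.restrict (Ioc a b)).prod (volume.restrict Ω)) := by
  have := isFiniteMeasure_restrict_of_isBounded hb
  have hmeas : MeasurableSet (Ioc a b ×ˢ Ω) := measurableSet_Ioc.prod hΩ
  have hsub : Ioc a b ×ˢ Ω ⊆ Icc a b ×ˢ closure Ω := prod_mono Ioc_subset_Icc_self subset_closure
  obtain ⟨C, hC⟩ := (isCompact_Icc.prod hb.isCompact_closure).exists_bound_of_continuousOn hΦ
  have h1 : Integrable (fun p : ℝ × Sp N => k p.1)
      ((volume.restrict (Ioc a b)).prod (volume.restrict Ω)) := by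
    exact Integrable.comp_fst (show Integrable k (volume.restrict (Ioc a b)) from hk) _
  have h2 : AEStronglyMeasurable (Function.uncurry Φ)
      ((volume.restrict (Ioc a b)).prod (volume.restrict Ω)) := by
    rw [Measure.prod_restrict]
    exact (hΦ.mono hsub).aestronglyMeasurable hmeas
  refine (h1.norm.mul_const C).mono' (h1.aestronglyMeasurable.smul h2) ?_
  rw [Measure.prod_restrict]
  filter_upwards [ae_restrict_mem hmeas] with p hp
  simp only [Function.uncurry, norm_smul]
  gcongr
  exact hC p (hsub hp)

theorem integral_integral_smul_swap (hΩ : MeasurableSet Ω) (hb : Bornology.IsBounded Ω) {a b : ℝ}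
    (hab : a ≤ b) {Φ : ℝ → Sp N → 𝕜}
    (hΦ : ContinuousOn (Function.uncurry Φ) (Icc a b ×ˢ closure Ω))
    {k : ℝ → ℝ} (hk : IntegrableOn k (Ioc a b)) :
    Integrable (fun x => ∫ s in a..b, k s • Φ s x) (volume.restrict Ω) ∧
    ∫ x in Ω, ∫ s in a..b, k s • Φ s x = ∫ s in a..b, k s • ∫ x in Ω, Φ s x := by
  have hi := integrable_smul_prod hΩ hb hΦ hk
  constructor
  · have := hi.integral_prod_right
    simpa only [intervalIntegral.integral_of_le hab, Function.uncurry] using this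
  · rw [← intervalIntegral_integral_swap (by rwa [uIoc_of_le hab])]
    simp only [integral_smul]

/-- Without joint continuity of `u`, integrability on the product comes from Carathéodory
measurability together with an `L₁` bound uniform in `s`. -/
theorem integral_integral_swap_of_continuousOn (hΩ : MeasurableSet Ω)
    (hb : Bornology.IsBounded Ω) {a b : ℝ} (hab : a ≤ b) {u : Sp N → ℝ → 𝕜} {ψ : Sp N → 𝕜}
    (hψ : ContinuousOn ψ (closure Ω)) (hc : ∀ s ∈ Ioc a b, ContinuousOn (fun x => u x s) Ω)
    (hm : ∀ x ∈ Ω, IntervalIntegrable (u x) volume a b) {C : ℝ}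
    (hC : ∀ s ∈ Ioc a b, Integrable (fun x => u x s) (volume.restrict Ω) ∧
      ∫ x in Ω, ‖u x s‖ ≤ C) :
    ∫ x in Ω, (∫ s in a..b, u x s) * ψ x = ∫ s in a..b, ∫ x in Ω, u x s * ψ x := by
  have := isFiniteMeasure_restrict_of_isBounded hb
  obtain ⟨M, hM⟩ := exists_norm_le_of_continuousOn_closure hb hψ
  have hψm : AEStronglyMeasurable ψ (volume.restrict Ω) :=
    (hψ.mono subset_closure).aestronglyMeasurable hΩ
  have hM' : ∀ᵐ x ∂(volume.restrict Ω), ‖ψ x‖ ≤ M := by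
    filter_upwards [ae_restrict_mem hΩ] with x hx using hM x (subset_closure hx)
  set ν : Measure ℝ := volume.restrict (Ioc a b) with hν
  have hmem : ∀ᵐ s ∂ν, s ∈ Ioc a b := ae_restrict_mem measurableSet_Ioc
  have hum : AEStronglyMeasurable (Function.uncurry u) ((volume.restrict Ω).prod ν) := by
    refine aestronglyMeasurable_uncurry_of_continuousOn hΩ hb ?_
      fun x hx => (hm x hx).1.aestronglyMeasurable
    filter_upwards [hmem] with s hs using hc s hs
  have hint : Integrable (Function.uncurry u) ((volume.restrict Ω).prod ν) := by
    refine (integrable_prod_iff' hum).2 ⟨?_, ?_⟩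
    · filter_upwards [hmem] with s hs using (hC s hs).1
    · refine Integrable.of_bound hum.norm.prod_swap.integral_prod_right' C ?_
      filter_upwards [hmem] with s hs
      rw [Real.norm_of_nonneg (integral_nonneg fun x => norm_nonneg _)]
      exact (hC s hs).2
  have hint' : Integrable (Function.uncurry fun x s => u x s * ψ x)
      ((volume.restrict Ω).prod ν) := by
    refine hint.mul_bdd (c := M) (hψm.comp_fst (ν := ν)) ?_
    exact Measure.quasiMeasurePreserving_fst.ae hM'
  have hswap := integral_integral_swap hint'
  rw [intervalIntegral.integral_of_le hab, ← hswap]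
  refine integral_congr_ae (Eventually.of_forall fun x => ?_)
  simp only
  rw [intervalIntegral.integral_of_le hab, integral_mul_const]

end Fubini

/-! ### The Volterra equation for a Fourier coefficient -/

section Coefficient

variable {𝕜 : Type} [RCLike 𝕜] {N : ℕ} {Ω : Set (Sp N)}

theorem continuousOn_uncurry_mul {I K : Set ℝ} {F : Sp N → ℝ → 𝕜} {ψ : Sp N → 𝕜}
    (hF : ContinuousOn (Function.uncurry F) (closure Ω ×ˢ I)) (hψ : ContinuousOn ψ (closure Ω))
    (hK : K ⊆ I) :
    ContinuousOn (Function.uncurry fun s x => F x s * ψ x) (K ×ˢ closure Ω) := by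
  refine ContinuousOn.mul ?_ (hψ.comp continuousOn_snd fun p hp => hp.2)
  exact hF.comp continuous_swap.continuousOn fun p hp => ⟨hp.2, hK hp.1⟩

theorem integrableOn_sub_rpow {ρ t : ℝ} (h0 : 0 < ρ) (ht : 0 ≤ t) :
    IntegrableOn (fun s => (t - s) ^ (ρ - 1)) (Ioc 0 t) := by
  have : IntervalIntegrable (fun s : ℝ => s ^ (ρ - 1)) volume 0 t :=
    intervalIntegral.intervalIntegrable_rpow' (by linarith)
  rw [← intervalIntegrable_iff_integrableOn_Ioc_of_le ht]
  simpa using (this.comp_sub_left t).symm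

/-- The integral is bounded by `M t^ρ / ρ`. -/
theorem tendsto_integral_rpow_smul_zero {ρ M : ℝ} (h0 : 0 < ρ) {J : ℝ → 𝕜}
    (hM : ∀ t ∈ Ioc (0 : ℝ) 1, ‖J t‖ ≤ M) :
    Tendsto (fun t => ∫ s in (0 : ℝ)..t, ((t - s) ^ (ρ - 1) : ℝ) • J s) (𝓝[>] 0) (𝓝 0) := by
  have hlim : Tendsto (fun t : ℝ => t ^ ρ / ρ * M) (𝓝[>] 0) (𝓝 0) := by
    have : Tendsto (fun t : ℝ => t ^ ρ / ρ * M) (𝓝 0) (𝓝 ((0 : ℝ) ^ ρ / ρ * M)) :=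
      (((Real.continuousAt_rpow_const 0 ρ (Or.inr h0.le)).tendsto).div_const ρ).mul_const M
    rw [Real.zero_rpow h0.ne', zero_div, zero_mul] at this
    exact this.mono_left nhdsWithin_le_nhds
  refine squeeze_zero_norm' ?_ hlim
  filter_upwards [Ioc_mem_nhdsGT (zero_lt_one (α := ℝ))] with t ht
  have hi : IntervalIntegrable (fun s => (t - s) ^ (ρ - 1)) volume 0 t :=
    (intervalIntegrable_iff_integrableOn_Ioc_of_le ht.1.le).2 (integrableOn_sub_rpow h0 ht.1.le)
  have he : ∫ s in (0 : ℝ)..t, (t - s) ^ (ρ - 1) = t ^ ρ / ρ := by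
    rw [intervalIntegral.integral_comp_sub_left (fun s : ℝ => s ^ (ρ - 1)), sub_self, sub_zero,
      integral_rpow (Or.inl (by linarith)), sub_add_cancel, Real.zero_rpow h0.ne', sub_zero]
  rw [← he, ← intervalIntegral.integral_mul_const]
  refine intervalIntegral.norm_integral_le_of_norm_le ht.1.le
    (Eventually.of_forall fun s hs => ?_) (hi.mul_const M)
  have hs' : 0 ≤ (t - s) ^ (ρ - 1) := Real.rpow_nonneg (sub_nonneg.2 hs.2) _
  rw [norm_smul, Real.norm_of_nonneg hs']
  exact mul_le_mul_of_nonneg_left (hM s ⟨hs.1, hs.2.trans ht.2⟩) hs'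

/-- Let `H = ∂_t^{ρ-1} u`, `G = ∂_t H`, `H(·,0) = 0`. If the coefficients of `u` and `G` with
respect to `ψ` are proportional, then the coefficient of `H` satisfies a homogeneous Volterra
equation, and hence vanishes. -/
theorem integral_mul_eq_zero (hΩ : MeasurableSet Ω) (hb : Bornology.IsBounded Ω) {ρ : ℝ}
    (h0 : 0 < ρ) {u H G : Sp N → ℝ → 𝕜} {ψ : Sp N → 𝕜} {κ : 𝕜} (hκ : κ ≠ 0)
    (hψ : ContinuousOn ψ (closure Ω))
    (hH : ContinuousOn (Function.uncurry H) (closure Ω ×ˢ Ici 0))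
    (hG : ContinuousOn (Function.uncurry G) (closure Ω ×ˢ Ioi 0))
    (hH0 : ∀ x ∈ Ω, H x 0 = 0)
    (hder : ∀ x ∈ Ω, ∀ t > 0, HasDerivAt (H x) (G x t) t)
    (hu : ∀ t > 0, ContinuousOn (fun x => u x t) Ω)
    (hui : ∀ x ∈ Ω, ∀ t > 0, IntervalIntegrable (u x) volume 0 t)
    (huH : ∀ x ∈ Ω, ∀ t > 0,
      (Real.Gamma ρ)⁻¹ • ∫ s in (0 : ℝ)..t, ((t - s) ^ (ρ - 1) : ℝ) • H x s =
      ∫ s in (0 : ℝ)..t, u x s)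
    (hub : ∀ ε > 0, ∀ R, ∃ C, ∀ s ∈ Icc ε R, Integrable (fun x => u x s) (volume.restrict Ω) ∧
      ∫ x in Ω, ‖u x s‖ ≤ C)
    (huG : ∀ t > 0, ∫ x in Ω, u x t * ψ x = κ * ∫ x in Ω, G x t * ψ x) :
    ∀ t > 0, ∫ x in Ω, H x t * ψ x = 0 := by
  have hfin := isFiniteMeasure_restrict_of_isBounded hb
  set J : ℝ → 𝕜 := fun t => ∫ x in Ω, H x t * ψ x with hJ
  set y : ℝ → 𝕜 := fun t =>
    (Real.Gamma ρ)⁻¹ • ∫ s in (0 : ℝ)..t, ((t - s) ^ (ρ - 1) : ℝ) • J s with hy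
  have hHc : ∀ t ≥ 0, ContinuousOn (fun x => H x t * ψ x) (closure Ω) := fun t ht =>
    (hH.comp (by fun_prop : ContinuousOn (fun x : Sp N => (x, t)) (closure Ω))
      fun x hx => ⟨hx, ht⟩).mul hψ
  have hHi : ∀ t ≥ 0, Integrable (fun x => H x t * ψ x) (volume.restrict Ω) := fun t ht =>
    memLp_one_iff_integrable.1 (memLp_of_continuousOn_closure hΩ hb (hHc t ht) 1)
  have hHb : ∀ R, ∃ M, ∀ t ∈ Icc 0 R, ∀ x ∈ Ω, ‖H x t * ψ x‖ ≤ M := fun R => by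
    obtain ⟨M, hM⟩ := (isCompact_Icc.prod hb.isCompact_closure).exists_bound_of_continuousOn
      (continuousOn_uncurry_mul hH hψ (K := Icc 0 R) Icc_subset_Ici_self)
    exact ⟨M, fun t ht x hx => hM (t, x) ⟨ht, subset_closure hx⟩⟩
  have hJb : ∀ R, ∃ C, ∀ t ∈ Ioc 0 R, ‖J t‖ ≤ C := fun R => by
    obtain ⟨M, hM⟩ := hHb R
    refine ⟨M * (volume.restrict Ω).real univ, fun t ht => ?_⟩
    refine norm_integral_le_of_norm_le_const ?_
    filter_upwards [ae_restrict_mem hΩ] with x hx using hM t ⟨ht.1.le, ht.2⟩ x hx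
  -- the coefficient of `∂_t^{-1} u`
  have hyu : ∀ t > 0, Integrable (fun x => (∫ s in (0 : ℝ)..t, u x s) * ψ x)
      (volume.restrict Ω) ∧ ∫ x in Ω, (∫ s in (0 : ℝ)..t, u x s) * ψ x = y t := fun t ht => by
    obtain ⟨h1, h2⟩ := integral_integral_smul_swap hΩ hb ht.le
      (continuousOn_uncurry_mul hH hψ (K := Icc 0 t) Icc_subset_Ici_self)
      (integrableOn_sub_rpow h0 ht.le)
    have he : (fun x => (Real.Gamma ρ)⁻¹ • ∫ s in (0 : ℝ)..t,
        ((t - s) ^ (ρ - 1) : ℝ) • (H x s * ψ x)) =ᵐ[volume.restrict Ω]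
        fun x => (∫ s in (0 : ℝ)..t, u x s) * ψ x := by
      filter_upwards [ae_restrict_mem hΩ] with x hx
      rw [← huH x hx t ht, smul_mul_assoc, ← intervalIntegral.integral_mul_const]
      simp only [smul_mul_assoc]
    refine ⟨(h1.smul (Real.Gamma ρ)⁻¹).congr he, ?_⟩
    rw [← integral_congr_ae he, integral_smul, h2]
  -- The time integral stays away from `0`, since `G` is continuous and the `L₁` norm of `u` is
  -- controlled only on `[ε, t]`.
  have hdiff : ∀ ε > 0, ∀ t, ε < t → y t - y ε = κ * (J t - J ε) := fun ε hε t ht => by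
    have hsub : Icc ε t ⊆ Ioi 0 := fun s hs => hε.trans_le hs.1
    obtain ⟨C, hC⟩ := hub ε hε t
    have e1 : y t - y ε = ∫ x in Ω, (∫ s in ε..t, u x s) * ψ x := by
      rw [← (hyu t (hε.trans ht)).2, ← (hyu ε hε).2,
        ← integral_sub (hyu t (hε.trans ht)).1 (hyu ε hε).1]
      refine setIntegral_congr_fun hΩ fun x hx => ?_
      rw [← sub_mul, intervalIntegral.integral_interval_sub_left (hui x hx t (hε.trans ht))
        (hui x hx ε hε)]
    have e2 : ∫ x in Ω, (∫ s in ε..t, u x s) * ψ x = ∫ s in ε..t, ∫ x in Ω, u x s * ψ x :=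
      integral_integral_swap_of_continuousOn hΩ hb ht.le hψ
        (fun s hs => hu s (hε.trans hs.1))
        (fun x hx => (hui x hx ε hε).symm.trans (hui x hx t (hε.trans ht)))
        (C := C) fun s hs => hC s ⟨hs.1.le, hs.2⟩
    have e3 : ∫ s in ε..t, ∫ x in Ω, u x s * ψ x =
        κ * ∫ s in ε..t, ∫ x in Ω, G x s * ψ x := by
      rw [← intervalIntegral.integral_const_mul]
      refine intervalIntegral.integral_congr fun s hs => huG s ?_
      rw [uIcc_of_le ht.le] at hs
      exact hsub hs
    have e4 : ∫ s in ε..t, ∫ x in Ω, G x s * ψ x = J t - J ε := by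
      have h := (integral_integral_smul_swap hΩ hb ht.le
        (continuousOn_uncurry_mul hG hψ (K := Icc ε t) hsub) (k := fun _ => 1)
        (integrableOn_const (by simp))).2
      simp only [one_smul] at h
      rw [← h, hJ]
      simp only
      rw [← integral_sub (hHi t (hε.trans ht).le) (hHi ε hε.le)]
      refine setIntegral_congr_fun hΩ fun x hx => ?_
      rw [intervalIntegral.integral_mul_const, ← sub_mul]
      congr 1
      refine intervalIntegral.integral_eq_sub_of_hasDerivAt (fun s hs => hder x hx s ?_) ?_
      · rw [uIcc_of_le ht.le] at hs
        exact hsub hs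
      · refine ContinuousOn.intervalIntegrable ?_
        rw [uIcc_of_le ht.le]
        exact hG.comp (by fun_prop : ContinuousOn (fun s : ℝ => (x, s)) (Icc ε t))
          fun s hs => ⟨subset_closure hx, hsub hs⟩
    rw [e1, e2, e3, e4]
  have hJ0 : Tendsto J (𝓝[>] 0) (𝓝 0) := by
    obtain ⟨M, hM⟩ := hHb 1
    have hmem : Ioc (0 : ℝ) 1 ∈ 𝓝[>] (0 : ℝ) := Ioc_mem_nhdsGT zero_lt_one
    have := tendsto_integral_filter_of_dominated_convergence (μ := volume.restrict Ω)
      (l := 𝓝[>] (0 : ℝ)) (F := fun t x => H x t * ψ x) (f := fun _ => (0 : 𝕜)) (fun _ => M)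
      ?_ ?_ (integrable_const M) ?_
    · simpa using this
    · filter_upwards [hmem] with t ht using (hHi t ht.1.le).aestronglyMeasurable
    · filter_upwards [hmem] with t ht
      filter_upwards [ae_restrict_mem hΩ] with x hx using hM t ⟨ht.1.le, ht.2⟩ x hx
    · filter_upwards [ae_restrict_mem hΩ] with x hx
      have hc : ContinuousOn (fun s => H x s) (Ici 0) :=
        hH.comp (by fun_prop : ContinuousOn (fun s : ℝ => (x, s)) (Ici 0))
          fun s hs => ⟨subset_closure hx, hs⟩
      have h := ((hc 0 self_mem_Ici).mono Ioi_subset_Ici_self).tendsto.mul_const (ψ x)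
      rwa [hH0 x hx, zero_mul] at h
  have hy0 : Tendsto y (𝓝[>] 0) (𝓝 0) := by
    obtain ⟨C, hC⟩ := hJb 1
    simpa using (tendsto_integral_rpow_smul_zero h0 hC).const_smul (Real.Gamma ρ)⁻¹
  have hyJ : ∀ t > 0, y t = κ * J t := fun t ht => by
    have h1 : Tendsto (fun ε => y t - y ε) (𝓝[>] 0) (𝓝 (y t - 0)) := hy0.const_sub _
    have h2 : Tendsto (fun ε => κ * (J t - J ε)) (𝓝[>] 0) (𝓝 (κ * (J t - 0))) :=
      (hJ0.const_sub _).const_mul _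
    have h3 : (fun ε => y t - y ε) =ᶠ[𝓝[>] 0] fun ε => κ * (J t - J ε) := by
      filter_upwards [Ioo_mem_nhdsGT ht] with ε hε using hdiff ε hε.1 t hε.2
    simpa using tendsto_nhds_unique (h1.congr' h3) h2
  intro t ht
  refine eq_zero_of_norm_le_norm_integral_rpow_smul (R := t)
    (c := ‖κ‖⁻¹ * (Real.Gamma ρ)⁻¹) h0 ?_ (hJb t) (fun s hs => ?_) t ⟨ht, le_rfl⟩
  · have := Real.Gamma_pos_of_pos h0
    positivity
  · have h := congrArg norm (hyJ s hs.1)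
    rw [norm_mul, hy] at h
    simp only at h
    rw [norm_smul, Real.norm_of_nonneg (inv_nonneg.2 (Real.Gamma_pos_of_pos h0).le)] at h
    rw [mul_assoc, h, inv_mul_cancel_left₀ (norm_ne_zero_iff.2 hκ)]

end Coefficient

/-! ### Operators with a complete orthonormal system of eigenvectors -/

section Diagonal

variable {𝕜 E ι : Type*} [RCLike 𝕜] [NormedAddCommGroup E] [InnerProductSpace 𝕜 E] {V : ι → E}

/-- Both sides are continuous linear functionals of `F` that agree on the `V j`, whose span is
dense; self-adjointness of `T` need not be assumed. -/
theorem inner_apply_of_eigenvectors (hV : Orthonormal 𝕜 V)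
    (hd : (Submodule.span 𝕜 (range V)).topologicalClosure = ⊤) {T : E →L[𝕜] E} {c : ι → 𝕜}
    (hT : ∀ k, T (V k) = c k • V k) (k : ι) (F : E) :
    inner 𝕜 (V k) (T F) = c k * inner 𝕜 (V k) F := by
  classical
  have h : (innerSL 𝕜 (V k)).comp T = c k • innerSL 𝕜 (V k) := by
    refine ContinuousLinearMap.ext_on
      ((Submodule.dense_iff_topologicalClosure_eq_top).2 hd) ?_
    rintro _ ⟨j, rfl⟩
    have hVj := (orthonormal_iff_ite.1 hV) k j
    simp only [ContinuousLinearMap.comp_apply, _root_.smul_apply, innerSL_apply_apply,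
      hT, inner_smul_right, hVj, smul_eq_mul]
    split_ifs with hkj
    · rw [hkj]
    · simp
  simpa using congrArg (fun L => L F) h

theorem eq_zero_of_forall_inner_eq_zero
    (hd : (Submodule.span 𝕜 (range V)).topologicalClosure = ⊤) {F : E}
    (hF : ∀ k, inner 𝕜 (V k) F = 0) : F = 0 := by
  have h : innerSL 𝕜 F = 0 := by
    refine ContinuousLinearMap.ext_on
      ((Submodule.dense_iff_topologicalClosure_eq_top).2 hd) ?_
    rintro _ ⟨j, rfl⟩
    simp [inner_eq_zero_symm.1 (hF j)]
  simpa using congrArg (fun L => L F) h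

end Diagonal

/-! ### The homogeneous problem -/

section Homogeneous

variable {𝕜 : Type} [RCLike 𝕜] {N : ℕ} {Ω : Set (Sp N)}

theorem inner_eq_integral_mul_star {F G : L2 𝕜 Ω} {f g : Sp N → 𝕜}
    (hF : F =ᵐ[volume.restrict Ω] f) (hG : G =ᵐ[volume.restrict Ω] g) :
    inner 𝕜 F G = ∫ x in Ω, g x * star (f x) := by
  rw [L2.inner_def]
  refine integral_congr_ae ?_
  filter_upwards [hF, hG] with x hx hx'
  rw [hx, hx', RCLike.inner_apply, starRingEnd_apply]

/-- Hölder's inequality on a set of finite measure; the constant does not depend on the function and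
so serves all times at once. -/
theorem integral_norm_le_L2_norm (hb : Bornology.IsBounded Ω) :
    ∃ C, ∀ (F : L2 𝕜 Ω) (f : Sp N → 𝕜), F =ᵐ[volume.restrict Ω] f →
      ∫ x in Ω, ‖f x‖ ≤ C * ‖F‖ := by
  have := isFiniteMeasure_restrict_of_isBounded hb
  set c : ENNReal := (volume.restrict Ω) univ ^
    (1 / (1 : ENNReal).toReal - 1 / (2 : ENNReal).toReal) with hc
  have hct : c ≠ ⊤ := ENNReal.rpow_ne_top_of_nonneg (by norm_num) (measure_ne_top _ _)
  refine ⟨c.toReal, fun F f hF => ?_⟩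
  have hm := Lp.aestronglyMeasurable F
  have h := eLpNorm_le_eLpNorm_mul_rpow_measure_univ (p := 1) (q := 2) (by norm_num) hm
  have h' := ENNReal.toReal_mono (ENNReal.mul_ne_top (Lp.eLpNorm_ne_top F) hct) h
  rw [ENNReal.toReal_mul, ← Lp.norm_def, mul_comm] at h'
  refine le_trans (le_of_eq ?_) h'
  rw [eLpNorm_congr_ae hF, eLpNorm_one_eq_lintegral_enorm,
    integral_norm_eq_lintegral_enorm (hm.congr hF)]

/-- For `ρ < 1` this is the semigroup law. For `ρ = 1` the function `H` is `h` itself, the kernel is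
`1`, and local integrability comes from the continuity of `H` up to `0`. -/
theorem intervalIntegrable_of_rlIntExists {ρ : ℝ} (h0 : 0 < ρ) (h1 : ρ ≤ 1) {h H : ℝ → 𝕜}
    (hex : ∀ t > 0, RlIntExists (ρ - 1) h t) (hH : ContinuousOn H (Ici 0))
    (hHh : ∀ t > 0, H t = rlInt (ρ - 1) h t) {t : ℝ} (ht : 0 < t) :
    IntervalIntegrable h volume 0 t ∧
      (Real.Gamma ρ)⁻¹ • ∫ s in (0 : ℝ)..t, ((t - s) ^ (ρ - 1) : ℝ) • H s =
        ∫ s in (0 : ℝ)..t, h s := by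
  have hcongr : ∫ s in (0 : ℝ)..t, ((t - s) ^ (ρ - 1) : ℝ) • H s =
      ∫ s in (0 : ℝ)..t, ((t - s) ^ (ρ - 1) : ℝ) • rlInt (ρ - 1) h s := by
    refine intervalIntegral.integral_congr_ae (Eventually.of_forall fun s hs => ?_)
    rw [uIoc_of_le ht.le] at hs
    rw [hHh s hs.1]
  rcases h1.lt_or_eq with h1 | rfl
  · have hi : IntervalIntegrable h volume 0 t := by
      refine intervalIntegrable_of_rpow_smul h0 ht ?_
      have := hex t ht (by linarith)
      rwa [show -(ρ - 1) - 1 = -ρ by ring] at this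
    exact ⟨hi, hcongr ▸ integral_rpow_smul_rlInt h0 h1 ht hi⟩
  · have he : ∀ s ∈ Ioc 0 t, H s = h s := fun s hs => by simp [hHh s hs.1, rlInt]
    have hHi : IntervalIntegrable H volume 0 t := by
      refine ContinuousOn.intervalIntegrable (hH.mono ?_)
      rw [uIcc_of_le ht.le]
      exact Icc_subset_Ici_self
    constructor
    · refine hHi.congr ?_
      rwa [uIoc_of_le ht.le]
    · rw [hcongr]
      simp [rlInt]

theorem IsRegularSolution.eq_zero (hΩ : IsOpen Ω) (hb : Bornology.IsBounded Ω) {l : ℕ}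
    {a : (Fin N → ℕ) → Sp N → 𝕜} {mB : Fin l → ℕ} {b : Fin l → (Fin N → ℕ) → Sp N → 𝕜}
    (hA : ConditionA Ω l a mB b) {ρ : ℝ} (h0 : 0 < ρ) (h1 : ρ ≤ 1) {u : Sp N → ℝ → 𝕜}
    (hu : IsRegularSolution Ω l a mB b ρ 0 0 u) : ∀ x ∈ closure Ω, ∀ t > 0, u x t = 0 := by
  have hfin := isFiniteMeasure_restrict_of_isBounded hb
  have hΩm := hΩ.measurableSet
  obtain ⟨T, -, hT⟩ := hA.compact_inverse
  obtain ⟨v, lam, V, hvD, hlam, hv, hVv, hVo, hVd⟩ := hA.eigenfunctions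
  obtain ⟨G, hG, hGu⟩ := hu.continuous_rlDeriv
  obtain ⟨H, hH, hHu⟩ := hu.continuous_rlInt
  have hGt : ∀ t > 0, ContinuousOn (fun x => G x t) (closure Ω) := fun t ht =>
    hG.comp (by fun_prop : ContinuousOn (fun x : Sp N => (x, t)) (closure Ω))
      fun x hx => ⟨hx, ht⟩
  have hHt : ∀ t > 0, ContinuousOn (fun x => H x t) (closure Ω) := fun t ht =>
    hH.comp (by fun_prop : ContinuousOn (fun x : Sp N => (x, t)) (closure Ω))
      fun x hx => ⟨hx, le_of_lt ht⟩
  have hHx : ∀ x ∈ Ω, ContinuousOn (H x) (Ici 0) := fun x hx =>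
    hH.comp (by fun_prop : ContinuousOn (fun s : ℝ => (x, s)) (Ici 0))
      fun s hs => ⟨subset_closure hx, hs⟩
  have hHev : ∀ x ∈ Ω, ∀ t > 0, H x =ᶠ[𝓝 t] rlInt (ρ - 1) (u x) := fun x hx t ht => by
    filter_upwards [Ioi_mem_nhds ht] with s hs using hHu x hx s hs
  have hder : ∀ x ∈ Ω, ∀ t > 0, HasDerivAt (H x) (G x t) t := fun x hx t ht => by
    rw [hGu x hx t ht]
    exact (hu.deriv_exists x hx t ht).hasDerivAt.congr_of_eventuallyEq (hHev x hx t ht)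
  -- The extension `H` is tied to `∂_t^{ρ-1} u` only for `t > 0`; its value at `0` follows from
  -- continuity and the initial condition.
  have hH0 : ∀ x ∈ Ω, H x 0 = 0 := fun x hx => by
    have h := ((hHx x hx 0 self_mem_Ici).mono Ioi_subset_Ici_self).tendsto
    refine tendsto_nhds_unique h ((hu.initial x hx).congr' ?_)
    filter_upwards [self_mem_nhdsWithin] with s hs using (hHu x hx s hs).symm
  -- `u(·,t)` is the image of `-∂_t^ρ u(·,t)` under the inverse of `A`
  have hTu : ∀ t > 0, ∀ U F : L2 𝕜 Ω, U =ᵐ[volume.restrict Ω] (fun x => u x t) →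
      F =ᵐ[volume.restrict Ω] (fun x => G x t) → U = -T F := fun t ht U F hU hF => by
    rw [← map_neg]
    refine (hT (fun x => u x t) ⟨hu.space_regular t ht, fun j => hu.boundary j t ht⟩ (-F) U
      ?_ hU).symm
    filter_upwards [Lp.coeFn_neg F, hF, ae_restrict_mem hΩm] with x hx hx' hxΩ
    have := hu.equation x hxΩ t ht
    rw [hx, Pi.neg_apply, hx', hGu x hxΩ t ht]
    exact neg_eq_of_add_eq_zero_right this
  have hex : ∀ g : Sp N → 𝕜, ContinuousOn g (closure Ω) →
      ∃ F : L2 𝕜 Ω, F =ᵐ[volume.restrict Ω] g := fun g hg =>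
    ⟨(memLp_of_continuousOn_closure hΩm hb hg 2).toLp, MemLp.coeFn_toLp _⟩
  have hTV : ∀ k, T (V k) = ((lam k : 𝕜)⁻¹) • V k := fun k => by
    have hne : (lam k : 𝕜) ≠ 0 := RCLike.ofReal_ne_zero.2 (hlam k).ne'
    have : T ((lam k : 𝕜) • V k) = V k := by
      refine hT (v k) (hvD k) _ _ ?_ (hVv k)
      filter_upwards [Lp.coeFn_smul (lam k : 𝕜) (V k), hVv k, ae_restrict_mem hΩm]
        with x hx hx' hxΩ
      rw [hx, Pi.smul_apply, hx', hv k x hxΩ, smul_eq_mul]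
    rw [eq_inv_smul_iff₀ hne, ← map_smul, this]
  have hHzero : ∀ k, ∀ t > 0, ∫ x in Ω, H x t * star (v k x) = 0 := fun k => by
    have hne : (lam k : 𝕜) ≠ 0 := RCLike.ofReal_ne_zero.2 (hlam k).ne'
    refine integral_mul_eq_zero hΩm hb h0 (κ := -(lam k : 𝕜)⁻¹) (neg_ne_zero.2 (inv_ne_zero hne))
      (continuous_star.comp_continuousOn (hvD k).1.2.1) hH hG hH0 hder (u := u)
      (fun t ht => (hu.space_regular t ht).2.1.mono subset_closure)
      (fun x hx t ht => (intervalIntegrable_of_rlIntExists h0 h1 (hu.integral_exists x hx)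
        (hHx x hx) (hHu x hx) ht).1)
      (fun x hx t ht => (intervalIntegrable_of_rlIntExists h0 h1 (hu.integral_exists x hx)
        (hHx x hx) (hHu x hx) ht).2) ?_ ?_
    · intro ε hε R
      obtain ⟨M, hM⟩ := (hb.isCompact_closure.prod isCompact_Icc).exists_bound_of_continuousOn
        (hG.mono (prod_mono le_rfl fun s (hs : s ∈ Icc ε R) => hε.trans_le hs.1))
      obtain ⟨C, hC⟩ := integral_norm_le_L2_norm (𝕜 := 𝕜) hb
      -- The bound follows `G` through sup norm, `L₂` norm, the operator `T` and `L₁` norm, using `u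
      -- = -T G`; compactness of `Ω̄ × [ε, R]` supplies `M`.
      refine ⟨|C| * (‖T‖ *
        ((measureUnivNNReal (volume.restrict Ω) : ℝ) ^ (2 : ENNReal).toReal⁻¹ * |M|)),
        fun s hs => ?_⟩
      have hs0 : 0 < s := hε.trans_le hs.1
      have hus := (hu.space_regular s hs0).2.1
      refine ⟨memLp_one_iff_integrable.1 (memLp_of_continuousOn_closure hΩm hb hus 1), ?_⟩
      obtain ⟨U, hU⟩ := hex _ hus
      obtain ⟨F, hF⟩ := hex _ (hGt s hs0)
      have hFn : ‖F‖ ≤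
          (measureUnivNNReal (volume.restrict Ω) : ℝ) ^ (2 : ENNReal).toReal⁻¹ * |M| := by
        refine Lp.norm_le_of_ae_bound (abs_nonneg M) ?_
        filter_upwards [hF, ae_restrict_mem hΩm] with x hx hxΩ
        rw [hx]
        exact (hM (x, s) ⟨subset_closure hxΩ, hs⟩).trans (le_abs_self M)
      calc ∫ x in Ω, ‖u x s‖ ≤ C * ‖U‖ := hC U _ hU
        _ ≤ |C| * ‖U‖ := by gcongr; exact le_abs_self C
        _ ≤ _ := by
          rw [hTu s hs0 U F hU hF, norm_neg]
          gcongr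
          exact (T.le_opNorm F).trans (by gcongr)
    · intro t ht
      obtain ⟨U, hU⟩ := hex _ (hu.space_regular t ht).2.1
      obtain ⟨F, hF⟩ := hex _ (hGt t ht)
      rw [← inner_eq_integral_mul_star (hVv k) hU, ← inner_eq_integral_mul_star (hVv k) hF,
        hTu t ht U F hU hF, inner_neg_right, inner_apply_of_eigenvectors hVo hVd hTV, neg_mul]
  have hHΩ : ∀ t > 0, ∀ x ∈ Ω, H x t = 0 := fun t ht => by
    obtain ⟨F, hF⟩ := hex _ (hHt t ht)
    have hF0 : F = 0 := eq_zero_of_forall_inner_eq_zero hVd fun k => by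
      rw [inner_eq_integral_mul_star (hVv k) hF, hHzero k t ht]
    -- A continuous function that vanishes almost everywhere on an open set vanishes there
    -- identically.
    refine Measure.eqOn_open_of_ae_eq (μ := volume) (f := fun x => H x t) (g := fun _ => 0) ?_ hΩ
      ((hHt t ht).mono subset_closure) continuousOn_const
    rw [hF0] at hF
    exact hF.symm.trans (Lp.coeFn_zero _ _ _)
  have hGΩ : ∀ t > 0, ∀ x ∈ Ω, G x t = 0 := fun t ht x hx => by
    refine (hder x hx t ht).unique ((hasDerivAt_const t (0 : 𝕜)).congr_of_eventuallyEq ?_)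
    filter_upwards [Ioi_mem_nhds ht] with s hs using hHΩ s hs x hx
  intro x hx t ht
  have hut := (hu.space_regular t ht).2.1
  obtain ⟨U, hU⟩ := hex _ hut
  have hU0 : U = 0 := by
    rw [hTu t ht U 0 hU, map_zero, neg_zero]
    filter_upwards [Lp.coeFn_zero 𝕜 2 (volume.restrict Ω), ae_restrict_mem hΩm] with y hy hyΩ
    rw [hy, hGΩ t ht y hyΩ, Pi.zero_apply]
  have huΩ : EqOn (fun x => u x t) (fun _ => 0) Ω := by
    refine Measure.eqOn_open_of_ae_eq (μ := volume) ?_ hΩ (hut.mono subset_closure)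
      continuousOn_const
    rw [hU0] at hU
    exact hU.symm.trans (Lp.coeFn_zero _ _ _)
  exact huΩ.of_subset_closure hut continuousOn_const subset_closure le_rfl hx

end Homogeneous

end Subdiffusion

end

theorem theorem1 {𝕜 : Type} [RCLike 𝕜] {N : ℕ} (hN : 1 ≤ N)
    (Ω : Set (Subdiffusion.Sp N)) (hΩ : Subdiffusion.IsSmoothBoundedDomain Ω)
    (l : ℕ) (hl : 1 ≤ l)
    (a : (Fin N → ℕ) → Subdiffusion.Sp N → 𝕜) (ha : Subdiffusion.IsPosSymmElliptic Ω l a)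
    (mB : Fin l → ℕ) (hmB : ∀ j, mB j ≤ 2 * l - 1)
    (b : Fin l → (Fin N → ℕ) → Subdiffusion.Sp N → 𝕜)
    (hA : Subdiffusion.ConditionA Ω l a mB b)
    (ρ : ℝ) (hρ0 : 0 < ρ) (hρ1 : ρ ≤ 1)
    (f : Subdiffusion.Sp N → ℝ → 𝕜)
    (hf : ContinuousOn (Function.uncurry f) (closure Ω ×ˢ Set.Ioi 0))
    (φ : Subdiffusion.Sp N → 𝕜) (hφ : ContinuousOn φ (closure Ω))
    (u₁ u₂ : Subdiffusion.Sp N → ℝ → 𝕜)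
    (hu₁ : Subdiffusion.IsRegularSolution Ω l a mB b ρ f φ u₁)
    (hu₂ : Subdiffusion.IsRegularSolution Ω l a mB b ρ f φ u₂) :
    ∀ x ∈ closure Ω, ∀ t > 0, u₁ x t = u₂ x t := by
  intro x hx t ht
  have hu := hu₁.sub hΩ.isOpen (fun j => (hmB j).trans (Nat.sub_le _ _)) hu₂
  exact sub_eq_zero.1 (hu.eq_zero hΩ.isOpen hΩ.isBounded hA hρ0 hρ1 x hx t ht)
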